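/- For an integer $n\ge1$ and $q>0$, the Mallows distribution $P_n^q$ is the probability measure on the set $S_n$ of permutations $\sigma=\sigma_1\cdots\sigma_n$ of $\{1,\dots,n\}$ with $P_n^q(\{\sigma\})=q^{\mathrm{inv}(\sigma)}/Z_n(q)$, where $\mathrm{inv}(\sigma)$ is the number of pairs $i<j$ with $\sigma_i>\sigma_j$ and $Z_n(q)$ is the normalization constant. For $1\le k\le n-l+1$ let $A^{(n)}_{l;k}\subset S_n$ be the event that the numbers $k,k+1,\dots,k+l-1$ appear in a set of $l$ consecutive positions, that is, $\{\sigma_m,\dots,\sigma_{m+l-1}\}=\{k,\dots,k+l-1\}$ for some $m\in\{1,\dots,n-l+1\}$. Write $a_n\lesssim b_n$ if $\limsup_{n\to\infty}a_n/b_n\le1$. Let $l\ge2$ be an integer, let $c>0$ and $\alpha\in(0,1)$, and let $q_n=1-\frac c{n^\alpha}$. Then $$\frac{((l-1)!)^2}{(2l)!}\,\frac{c^{l-1}\,l!}{n^{\alpha(l-1)}}\ \lesssim\ P_n^{q_n}\big(A^{(n)}_{l;k_n}\big)\ \lesssim\ \frac1l\,\frac{c^{l-1}\,l!}{n^{\alpha(l-1)}}$$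 for every choice of $k_n\in\{1,\dots,n-l+1\}$, and both asymptotic inequalities are uniform over all such sequences: for every $\varepsilon>0$ there is an $N$ such that for all $n\ge N$ and all $k\in\{1,\dots,n-l+1\}$, $$\frac{((l-1)!)^2}{(2l)!}\,\frac{c^{l-1}\,l!}{n^{\alpha(l-1)}}\le(1+\varepsilon)\,P_n^{q_n}\big(A^{(n)}_{l;k}\big)\quad\text{and}\quad P_n^{q_n}\big(A^{(n)}_{l;k}\big)\le(1+\varepsilon)\,\frac1l\,\frac{c^{l-1}\,l!}{n^{\alpha(l-1)}}.$$ Moreover, if $\{k_n\}$ satisfies $\lim_{n\to\infty}\frac{\min(k_n,\,n-k_n)}{n^\alpha}=\infty$, then $$\frac{((l-1)!)^2}{(2l)!}\,\frac{c^{l-1}\,l!}{n^{\alpha(l-1)}}\ \lesssim\ P_n^{q_n}\big(A^{(n)}_{l;k_n}\big)\ \lesssim\ \Big(\int_0^1x^{l-1}e^{-(l-1)x}\,dx\Big)\frac{c^{l-1}\,l!}{n^{\alpha(l-1)}}.$$ -/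

import Mathlib

open Filter Topology

namespace Mallows

/-- `inv(σ)`: the number of pairs of positions `i < j` with `σ_i > σ_j`. -/
def inv {n : ℕ} (σ : Equiv.Perm (Fin n)) : ℕ :=
  (Finset.univ.filter fun p : Fin n × Fin n => p.1 < p.2 ∧ σ p.2 < σ p.1).card

/-- The normalization constant `Z_n(q) = ∑_σ q ^ inv(σ)` over all permutations of `[n]`. -/
noncomputable def Z (n : ℕ) (q : ℝ) : ℝ := ∑ σ : Equiv.Perm (Fin n), q ^ inv σ

/-- `P_n^q(A)`: the probability of the event `A` under the Mallows distribution with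
parameter `q` on the permutations of `[n]`, where `P_n^q({σ}) = q ^ inv(σ) / Z_n(q)`. -/
noncomputable def prob (n : ℕ) (q : ℝ) (A : Set (Equiv.Perm (Fin n))) : ℝ :=
  ∑ σ : Equiv.Perm (Fin n), A.indicator (fun σ => q ^ inv σ / Z n q) σ

/-- The event that the numbers `k, …, k + l - 1` occupy a block of positions
`m, …, m + l - 1` of `[n]`. Numbers and positions are counted from `1`, so that `i : Fin n`
stands for `i + 1`. -/
def clusterEvent (n l k : ℕ) : Set (Equiv.Perm (Fin n)) :=
  {σ | ∃ m : ℕ, 1 ≤ m ∧ m + l ≤ n + 1 ∧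
    σ '' {i : Fin n | (i : ℕ) + 1 ∈ Set.Ico m (m + l)} =
      {v : Fin n | (v : ℕ) + 1 ∈ Set.Ico k (k + l)}}

/-- `a_n ≲ b_n` as `n → ∞` for real sequences, with `b` eventually positive:
`limsup a_n / b_n ≤ 1`. -/
def AsympLE (a b : ℕ → ℝ) : Prop :=
  ∀ ε : ℝ, 0 < ε → ∀ᶠ n in atTop, a n ≤ (1 + ε) * b n

/-- `a_{n,k} ≲ b_{n,k}` as `n → ∞`, uniformly over all `k` in `K n`, with `b` eventually
positive there: `limsup_n sup_{k ∈ K n} a_{n,k} / b_{n,k} ≤ 1`. -/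
def UniformAsympLE (K : ℕ → Set ℕ) (a b : ℕ → ℕ → ℝ) : Prop :=
  ∀ ε : ℝ, 0 < ε → ∀ᶠ n in atTop, ∀ k ∈ K n, a n k ≤ (1 + ε) * b n k

end Mallows

namespace Mallows

/-! Write l = m + 1 and n = A + B + l, with B values below the block and A above it. A permutation
is built by inserting values in increasing order; an insertion with s entries to its right creates s
inversions, so all weights factor into q-integers. When the block values have just been inserted and
b smaller values lie to their right, the weight is [B]! [l]! q^(l b) (`blockWeight_self`). The A
larger values must then avoid the gaps inside the block, which gives an exact formula for the
probability (`prob_clusterEvent_eq`).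

Relative to all ways of inserting, `insertions` is the survival probability of the block. The
product h(r) = (1 - q^(r+1)) ⋯ (1 - q^(r+m)), with r the number of entries to the right, is harmonic
for this process and at most 1, so it bounds survival from below (`le_insertions`). From above,
survival is at most 1 (`insertions_le`), or at most h plus an error that decays with the number of
insertions (`insertions_le_add`).

Summing q^(l b) h(b) over b is a q-beta sum (`tsum_qPoch`, `qBeta_eq`); multiplied by 1 - q it tends
to β = (m!)^2 / (2m+1)! = ∫ x^m (1-x)^m. Summing q^(l b) alone gives the uniform constant 1/l. The
stated constants follow because β exceeds (m!)^2 / (2l)!, and 1 - x ≤ e^(-x) puts β below the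
exponential integral. Reverse-complement symmetry lets B be at least about n/2, so boundary terms
q^B vanish uniformly in k. -/

/-- The `q`-integer `[n] = 1 + q + ⋯ + q ^ (n - 1)`. -/
noncomputable def qInt (q : ℝ) (n : ℕ) : ℝ := ∑ i ∈ Finset.range n, q ^ i

lemma qInt_zero (q : ℝ) : qInt q 0 = 0 := by simp [qInt]

lemma qInt_add (q : ℝ) (a b : ℕ) : qInt q (a + b) = qInt q a + q ^ a * qInt q b := by
  simp only [qInt, Finset.sum_range_add, Finset.mul_sum, pow_add]

lemma qInt_mul_one_sub (q : ℝ) (n : ℕ) : qInt q n * (1 - q) = 1 - q ^ n :=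
  geom_sum_mul_neg q n

lemma qInt_nonneg {q : ℝ} (hq : 0 ≤ q) (n : ℕ) : 0 ≤ qInt q n :=
  Finset.sum_nonneg fun _ _ => pow_nonneg hq _

lemma one_le_qInt_succ {q : ℝ} (hq : 0 ≤ q) (n : ℕ) : 1 ≤ qInt q (n + 1) := by
  rw [add_comm, qInt_add]
  have := mul_nonneg (pow_nonneg hq 1) (qInt_nonneg hq n)
  simp only [qInt, Finset.range_one, Finset.sum_singleton, pow_zero] at this ⊢
  linarith

/-! ### Insertion of the largest value and the q-factorial -/

/-- The permutation of `[n + 1]` obtained from `τ` by inserting the largest value at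
position `j`. -/
def insertTop {n : ℕ} (j : Fin (n + 1)) (τ : Equiv.Perm (Fin n)) : Equiv.Perm (Fin (n + 1)) :=
  (finSuccEquiv' j).trans ((Equiv.optionCongr τ).trans (finSuccEquiv' (Fin.last n)).symm)

lemma insertTop_self {n : ℕ} (j : Fin (n + 1)) (τ : Equiv.Perm (Fin n)) :
    insertTop j τ j = Fin.last n := by
  simp [insertTop]

lemma insertTop_succAbove {n : ℕ} (j : Fin (n + 1)) (τ : Equiv.Perm (Fin n)) (i : Fin n) :
    insertTop j τ (j.succAbove i) = (τ i).castSucc := by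
  simp [insertTop]

lemma insertTop_bijective (n : ℕ) :
    Function.Bijective fun x : Fin (n + 1) × Equiv.Perm (Fin n) => insertTop x.1 x.2 := by
  rw [Fintype.bijective_iff_injective_and_card]
  refine ⟨?_, ?_⟩
  · rintro ⟨j, τ⟩ ⟨j', τ'⟩ h
    simp only at h
    have hj : j = j' := by
      apply (insertTop j τ).injective
      rw [insertTop_self, h, insertTop_self]
    subst hj
    have : τ = τ' := by
      ext i
      have h1 := insertTop_succAbove j τ i
      rw [h, insertTop_succAbove] at h1
      exact congrArg Fin.val (Fin.castSucc_injective _ h1).symm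
    rw [this]
  · simp [Fintype.card_perm, Nat.factorial_succ]

lemma sum_perm_succ {n : ℕ} (F : Equiv.Perm (Fin (n + 1)) → ℝ) :
    ∑ σ, F σ = ∑ j : Fin (n + 1), ∑ τ : Equiv.Perm (Fin n), F (insertTop j τ) := by
  rw [← Fintype.sum_prod_type']
  exact ((insertTop_bijective n).sum_comp F).symm

lemma inv_eq_sum {n : ℕ} (σ : Equiv.Perm (Fin n)) :
    inv σ = ∑ i, ∑ j, if i < j ∧ σ j < σ i then 1 else 0 := by
  rw [inv, Finset.card_filter, Fintype.sum_prod_type]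

/-- The largest value forms an inversion with exactly the n - j entries to its right, and the
relative order of the others is unchanged. -/
lemma inv_insertTop {n : ℕ} (j : Fin (n + 1)) (τ : Equiv.Perm (Fin n)) :
    inv (insertTop j τ) = (n - j) + inv τ := by
  rw [inv_eq_sum, inv_eq_sum, Fin.sum_univ_succAbove _ j]
  congr 1
  · have h : ∀ i : Fin (n + 1), (if j < i ∧ insertTop j τ i < insertTop j τ j then 1 else 0)
        = if j < i then 1 else 0 := by
      intro i
      refine if_congr ?_ rfl rfl
      refine and_iff_left_of_imp fun hi => ?_
      rw [insertTop_self, Fin.lt_last_iff_ne_last, ← insertTop_self j τ]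
      exact fun hh => hi.ne' ((insertTop j τ).injective hh)
    simp only [h]
    rw [← Finset.card_filter, Finset.filter_lt_eq_Ioi, Fin.card_Ioi]
    omega
  · refine Finset.sum_congr rfl fun i _ => ?_
    rw [Fin.sum_univ_succAbove _ j]
    rw [if_neg, zero_add]
    · refine Finset.sum_congr rfl fun i' _ => ?_
      simp [insertTop_succAbove]
    · rw [insertTop_self]
      exact fun h => absurd h.2 (not_lt.2 (Fin.le_last _))

/-- The `q`-factorial. -/
noncomputable def qFact (q : ℝ) (n : ℕ) : ℝ := ∏ i ∈ Finset.range n, qInt q (i + 1)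

lemma qFact_succ (q : ℝ) (n : ℕ) : qFact q (n + 1) = qFact q n * qInt q (n + 1) :=
  Finset.prod_range_succ _ _

lemma qFact_pos {q : ℝ} (hq : 0 ≤ q) (n : ℕ) : 0 < qFact q n :=
  Finset.prod_pos fun i _ => one_pos.trans_le (one_le_qInt_succ hq i)

lemma sum_pow_sub (q : ℝ) (n a b : ℕ) (h : a + b ≤ n + 1) :
    (∑ j : Fin (n + 1), if a ≤ (j : ℕ) ∧ (j : ℕ) < a + b then q ^ (n - (j : ℕ)) else 0)
      = q ^ (n + 1 - a - b) * qInt q b := by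
  rw [Fin.sum_univ_eq_sum_range (fun j => if a ≤ j ∧ j < a + b then q ^ (n - j) else 0) (n + 1),
    ← Finset.sum_filter]
  have : (Finset.range (n + 1)).filter (fun j => a ≤ j ∧ j < a + b) = Finset.Ico a (a + b) := by
    ext j
    simp only [Finset.mem_filter, Finset.mem_range, Finset.mem_Ico]
    omega
  rw [this, Finset.sum_Ico_eq_sum_range, qInt, Finset.mul_sum, add_tsub_cancel_left,
    ← Finset.sum_range_reflect]
  refine Finset.sum_congr rfl fun i hi => ?_
  rw [Finset.mem_range] at hi
  rw [← pow_add]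
  congr 1
  omega

lemma Z_eq_qFact (n : ℕ) (q : ℝ) : Z n q = qFact q n := by
  induction n with
  | zero => simp [Z, qFact, inv]
  | succ n ih =>
    rw [Z, sum_perm_succ, qFact_succ, ← ih]
    simp only [inv_insertTop, pow_add, ← Finset.mul_sum]
    rw [← Finset.sum_mul, mul_comm]
    congr 1
    have := sum_pow_sub q n 0 (n + 1) (by omega)
    simp only [zero_le, zero_add, Fin.is_lt, and_self, if_true] at this
    simpa using this

/-! ### Weights of permutations with a block at a given position -/

/-- The permutations of `[n]` that send the positions `p, …, p + l - 1` onto the values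
`k, …, k + l - 1`, both counted from `0`. -/
def blockAt (n l k p : ℕ) : Set (Equiv.Perm (Fin n)) :=
  {σ | ∀ i : Fin n, (p ≤ (i : ℕ) ∧ (i : ℕ) < p + l) ↔ (k ≤ (σ i : ℕ) ∧ (σ i : ℕ) < k + l)}

/-- The total weight `∑ q ^ inv` of `blockAt`. -/
noncomputable def blockWeight (q : ℝ) (n l k p : ℕ) : ℝ :=
  ∑ σ, (blockAt n l k p).indicator (fun σ => q ^ inv σ) σ

lemma blockWeight_zero (q : ℝ) (n k p : ℕ) : blockWeight q n 0 k p = qFact q n := by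
  rw [← Z_eq_qFact, blockWeight, Z]
  refine Finset.sum_congr rfl fun σ _ => Set.indicator_of_mem ?_ _
  intro i
  omega

lemma val_succAbove {n : ℕ} (j : Fin (n + 1)) (i : Fin n) :
    (j.succAbove i : ℕ) = if (i : ℕ) < j then (i : ℕ) else i + 1 := by
  rw [Fin.succAbove]
  split_ifs <;> simp_all [Fin.lt_def]

lemma insertTop_mem_blockAt {n l k p : ℕ} (j : Fin (n + 1)) (τ : Equiv.Perm (Fin n)) :
    insertTop j τ ∈ blockAt (n + 1) l k p ↔
      ((p ≤ (j : ℕ) ∧ (j : ℕ) < p + l) ↔ (k ≤ n ∧ n < k + l)) ∧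
      ∀ i : Fin n, (p ≤ (if (i : ℕ) < j then (i : ℕ) else i + 1) ∧
        (if (i : ℕ) < j then (i : ℕ) else i + 1) < p + l) ↔
          (k ≤ (τ i : ℕ) ∧ (τ i : ℕ) < k + l) := by
  rw [blockAt, Set.mem_ofPred_eq, Fin.forall_iff_succAbove j]
  simp only [insertTop_self, insertTop_succAbove, val_succAbove, Fin.val_last, Fin.val_castSucc]

open Classical in
lemma blockWeight_insertTop (q : ℝ) (n l k p : ℕ) :
    blockWeight q (n + 1) l k p = ∑ j : Fin (n + 1), q ^ (n - (j : ℕ)) *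
      ∑ τ, if insertTop j τ ∈ blockAt (n + 1) l k p then q ^ inv τ else 0 := by
  rw [blockWeight, sum_perm_succ]
  simp only [Set.indicator_apply, inv_insertTop, pow_add, Finset.mul_sum, mul_ite, mul_zero]

open Classical in
lemma blockWeight_eq_sum_ite (q : ℝ) (n l k p : ℕ) :
    blockWeight q n l k p = ∑ τ, if τ ∈ blockAt n l k p then q ^ inv τ else 0 := by
  simp only [blockWeight, Set.indicator_apply]

/-- The inserted value belongs to the block, so it must go into one of the l + 1 gaps in or next to
the shorter block; k - p entries lie beyond the block on the right. -/
lemma blockWeight_top (q : ℝ) (l k p : ℕ) (hp : p ≤ k) :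
    blockWeight q (k + l + 1) (l + 1) k p
      = blockWeight q (k + l) l k p * (q ^ (k - p) * qInt q (l + 1)) := by
  classical
  have h : ∀ (j : Fin (k + l + 1)) (τ : Equiv.Perm (Fin (k + l))),
      insertTop j τ ∈ blockAt (k + l + 1) (l + 1) k p ↔
        (p ≤ (j : ℕ) ∧ (j : ℕ) < p + (l + 1)) ∧ τ ∈ blockAt (k + l) l k p := by
    intro j τ
    rw [insertTop_mem_blockAt, blockAt, Set.mem_ofPred_eq]
    have hj := j.isLt
    constructor
    · rintro ⟨h1, h2⟩
      refine ⟨h1.2 (by omega), fun i => ?_⟩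
      have h3 := h2 i
      have h4 := (τ i).isLt
      split_ifs at h3 <;> omega
    · rintro ⟨h1, h2⟩
      refine ⟨by omega, fun i => ?_⟩
      have h3 := h2 i
      have h4 := (τ i).isLt
      split_ifs <;> omega
  have hs := sum_pow_sub q (k + l) p (l + 1) (by omega)
  rw [show k + l + 1 - p - (l + 1) = k - p by omega] at hs
  rw [blockWeight_insertTop, ← hs, Finset.mul_sum]
  refine Finset.sum_congr rfl fun j _ => ?_
  simp only [h, blockWeight_eq_sum_ite]
  by_cases hj : p ≤ (j : ℕ) ∧ (j : ℕ) < p + (l + 1)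
  · simp only [hj, true_and, and_self, if_true]
    ring
  · simp only [hj, false_and, if_false, Finset.sum_const_zero, mul_zero]

/-- The inserted value exceeds the whole block, so it lies to the left, shifting the block from p -
1 to p, or to the right. For p = 0 the truncated p - 1 is harmless, since its coefficient contains
[0] = 0. -/
lemma blockWeight_succ (q : ℝ) (n l k p : ℕ) (hk : k + l ≤ n) (hp : p + l ≤ n + 1) :
    blockWeight q (n + 1) l k p = q ^ (n + 1 - p) * qInt q p * blockWeight q n l k (p - 1)
      + qInt q (n + 1 - p - l) * blockWeight q n l k p := by
  classical
  have key : ∀ j : Fin (n + 1),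
      (∑ τ, if insertTop j τ ∈ blockAt (n + 1) l k p then q ^ inv τ else 0)
        = if (j : ℕ) < p then blockWeight q n l k (p - 1)
          else if p + l ≤ (j : ℕ) then blockWeight q n l k p else 0 := by
    intro j
    have hj := j.isLt
    simp only [blockWeight_eq_sum_ite]
    split_ifs with h1 h2
    · refine Finset.sum_congr rfl fun τ _ => if_congr ?_ rfl rfl
      rw [insertTop_mem_blockAt, blockAt, Set.mem_ofPred_eq]
      refine ⟨fun h i => ?_, fun h => ⟨by omega, fun i => ?_⟩⟩
      · have h3 := h.2 i
        split_ifs at h3 <;> omega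
      · have h3 := h i
        split_ifs <;> omega
    · refine Finset.sum_congr rfl fun τ _ => if_congr ?_ rfl rfl
      rw [insertTop_mem_blockAt, blockAt, Set.mem_ofPred_eq]
      refine ⟨fun h i => ?_, fun h => ⟨by omega, fun i => ?_⟩⟩
      · have h3 := h.2 i
        split_ifs at h3 <;> omega
      · have h3 := h i
        split_ifs <;> omega
    · refine Finset.sum_eq_zero fun τ _ => if_neg ?_
      rw [insertTop_mem_blockAt]
      rintro ⟨h3, -⟩
      omega
  have h1 := sum_pow_sub q n 0 p (by omega)
  have h2 := sum_pow_sub q n (p + l) (n + 1 - p - l) (by omega)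
  rw [show n + 1 - 0 - p = n + 1 - p by omega] at h1
  rw [show n + 1 - (p + l) - (n + 1 - p - l) = 0 by omega, pow_zero, one_mul] at h2
  rw [blockWeight_insertTop, ← h1, ← h2, Finset.sum_mul, Finset.sum_mul,
    ← Finset.sum_add_distrib]
  refine Finset.sum_congr rfl fun j _ => ?_
  rw [key]
  have hj := j.isLt
  by_cases ha : (j : ℕ) < p
  · rw [if_pos ha, if_pos ⟨by omega, by omega⟩, if_neg (by omega)]
    ring
  · rw [if_neg ha, if_neg (c := 0 ≤ (j : ℕ) ∧ (j : ℕ) < 0 + p) (by omega)]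
    by_cases hb : p + l ≤ (j : ℕ)
    · rw [if_pos hb, if_pos ⟨hb, by omega⟩]
      ring
    · rw [if_neg hb, if_neg (fun h => hb h.1)]
      ring

lemma blockWeight_self (q : ℝ) (l k p : ℕ) (hp : p ≤ k) :
    blockWeight q (k + l) l k p = qFact q k * qFact q l * q ^ (l * (k - p)) := by
  induction l with
  | zero => simp [blockWeight_zero, qFact]
  | succ l ih =>
    rw [← add_assoc, blockWeight_top q l k p hp, ih, qFact_succ, add_mul, pow_add, one_mul]
    ring

/-! ### Insertions that keep the block together -/

/-- The weighted count of the ways to insert `j` further top values without separating a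
block of length `l` that has `p` entries on its left and `r` entries on its right. -/
noncomputable def insertions (q : ℝ) (l : ℕ) : ℕ → ℕ → ℕ → ℝ
  | 0, _, _ => 1
  | j + 1, p, r => qInt q (r + 1) * insertions q l j p (r + 1)
      + q ^ (r + l) * qInt q (p + 1) * insertions q l j (p + 1) r

lemma sum_blockWeight_succ (q : ℝ) (l k N : ℕ) (hk : k ≤ N) (w : ℕ → ℕ → ℝ) :
    ∑ x ∈ Finset.HasAntidiagonal.antidiagonal (N + 1), blockWeight q (N + l + 1) l k x.1 * w x.1 x.2
      = ∑ x ∈ Finset.HasAntidiagonal.antidiagonal N, blockWeight q (N + l) l k x.1 *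
          (qInt q (x.2 + 1) * w x.1 (x.2 + 1)
            + q ^ (x.2 + l) * qInt q (x.1 + 1) * w (x.1 + 1) x.2) := by
  have h : ∀ x ∈ Finset.HasAntidiagonal.antidiagonal (N + 1),
      blockWeight q (N + l + 1) l k x.1 * w x.1 x.2
        = q ^ (x.2 + l) * qInt q x.1 * blockWeight q (N + l) l k (x.1 - 1) * w x.1 x.2
          + qInt q x.2 * blockWeight q (N + l) l k x.1 * w x.1 x.2 := by
    rintro ⟨p, r⟩ hx
    rw [Finset.HasAntidiagonal.mem_antidiagonal] at hx
    simp only at hx ⊢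
    rw [blockWeight_succ q (N + l) l k p (by omega) (by omega),
      show N + l + 1 - p = r + l by omega, show r + l - l = r by omega]
    ring
  rw [Finset.sum_congr rfl h, Finset.sum_add_distrib, Finset.Nat.sum_antidiagonal_succ,
    Finset.Nat.sum_antidiagonal_succ']
  -- The boundary terms p = 0 and r = 0 carry the factor [0] = 0, so both sums become sums over the
  -- smaller antidiagonal.
  simp only [qInt_zero, mul_zero, zero_mul, zero_add, add_tsub_cancel_right]
  rw [← Finset.sum_add_distrib]
  refine Finset.sum_congr rfl fun x _ => ?_
  ring

lemma sum_blockWeight_add (q : ℝ) (l k N j : ℕ) (hk : k ≤ N) :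
    ∑ x ∈ Finset.HasAntidiagonal.antidiagonal (N + j), blockWeight q (N + j + l) l k x.1
      = ∑ x ∈ Finset.HasAntidiagonal.antidiagonal N, blockWeight q (N + l) l k x.1 *
          insertions q l j x.1 x.2 := by
  induction j generalizing N with
  | zero => simp [insertions]
  | succ j ih =>
    rw [show N + (j + 1) = N + 1 + j by ring, ih (N + 1) (by omega),
      show N + 1 + l = N + l + 1 by ring, sum_blockWeight_succ q l k N hk]
    rfl

/-! ### Exact formula for the cluster probability, and its symmetry -/

lemma mem_clusterEvent_iff {N l k : ℕ} (σ : Equiv.Perm (Fin (N + l))) :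
    σ ∈ clusterEvent (N + l) l (k + 1) ↔ ∃ p ∈ Finset.range (N + 1), σ ∈ blockAt (N + l) l k p := by
  have h : ∀ p : ℕ, (σ '' {i : Fin (N + l) | (i : ℕ) + 1 ∈ Set.Ico (p + 1) (p + 1 + l)} =
      {v : Fin (N + l) | (v : ℕ) + 1 ∈ Set.Ico (k + 1) (k + 1 + l)}) ↔
        σ ∈ blockAt (N + l) l k p := by
    intro p
    rw [Set.ext_iff, blockAt, Set.mem_ofPred_eq, ← σ.forall_congr_right]
    refine forall_congr' fun i => ?_
    rw [σ.injective.mem_set_image]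
    simp only [Set.mem_ofPred_eq, Set.mem_Ico]
    refine iff_congr ?_ ?_ <;> omega
  constructor
  · rintro ⟨m, h1, h2, h3⟩
    obtain ⟨p, rfl⟩ : ∃ p, m = p + 1 := ⟨m - 1, by omega⟩
    exact ⟨p, Finset.mem_range.2 (by omega), (h p).1 h3⟩
  · rintro ⟨p, h1, h2⟩
    rw [Finset.mem_range] at h1
    exact ⟨p + 1, by omega, by omega, (h p).2 h2⟩

lemma blockAt_unique {n l k p p' : ℕ} (hl : 0 < l) (hp : p + l ≤ n) (hp' : p' + l ≤ n)
    {σ : Equiv.Perm (Fin n)} (h : σ ∈ blockAt n l k p) (h' : σ ∈ blockAt n l k p') : p = p' := by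
  have h1 := (h' ⟨p, by omega⟩).2 ((h ⟨p, by omega⟩).1 ⟨le_rfl, by simpa using hl⟩)
  have h2 := (h ⟨p', by omega⟩).2 ((h' ⟨p', by omega⟩).1 ⟨le_rfl, by simpa using hl⟩)
  exact le_antisymm h2.1 h1.1

lemma prob_clusterEvent_eq_sum (q : ℝ) {N l : ℕ} (k : ℕ) (hl : 0 < l) :
    prob (N + l) q (clusterEvent (N + l) l (k + 1))
      = (∑ x ∈ Finset.HasAntidiagonal.antidiagonal N, blockWeight q (N + l) l k x.1)
        / qFact q (N + l) := by
  classical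
  rw [Finset.Nat.sum_antidiagonal_eq_sum_range_succ_mk]
  simp only [prob, blockWeight, Z_eq_qFact]
  rw [Finset.sum_comm, Finset.sum_div]
  refine Finset.sum_congr rfl fun σ _ => ?_
  by_cases hσ : σ ∈ clusterEvent (N + l) l (k + 1)
  · obtain ⟨p, hp, hσp⟩ := (mem_clusterEvent_iff σ).1 hσ
    rw [Set.indicator_of_mem hσ, Finset.sum_eq_single_of_mem p hp, Set.indicator_of_mem hσp]
    intro p' hp' hne
    rw [Finset.mem_range] at hp hp'
    exact Set.indicator_of_notMem
      (fun h => hne (blockAt_unique hl (by omega) (by omega) h hσp)) _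
  · rw [Set.indicator_of_notMem hσ, Finset.sum_eq_zero, zero_div]
    intro p hp
    exact Set.indicator_of_notMem (fun h => hσ ((mem_clusterEvent_iff σ).2 ⟨p, hp, h⟩)) _

/-- Stop the construction when the block is complete: b counts the smaller values to its right, each
giving l inversions with the block, and A values remain to be inserted. -/
lemma prob_clusterEvent_eq (q : ℝ) (A B : ℕ) {l : ℕ} (hl : 0 < l) :
    prob (A + B + l) q (clusterEvent (A + B + l) l (B + 1))
      = (∑ b ∈ Finset.range (B + 1), q ^ (l * b) * insertions q l A (B - b) b)
        * (qFact q B * qFact q l / qFact q (B + A + l)) := by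
  rw [prob_clusterEvent_eq_sum q B hl, add_comm A B, sum_blockWeight_add q l B B A le_rfl,
    ← Finset.Nat.sum_antidiagonal_swap, Finset.Nat.sum_antidiagonal_eq_sum_range_succ_mk,
    Finset.sum_mul, Finset.sum_div]
  refine Finset.sum_congr rfl fun b hb => ?_
  rw [Finset.mem_range] at hb
  simp only [Prod.swap_prod_mk]
  rw [blockWeight_self q l B (B - b) (by omega), show B - (B - b) = b by omega]
  ring

lemma inv_rev_conj {n : ℕ} (σ : Equiv.Perm (Fin n)) :
    inv (Fin.revPerm.trans (σ.trans Fin.revPerm)) = inv σ := by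
  rw [inv_eq_sum, inv_eq_sum, Finset.sum_comm]
  refine Fintype.sum_equiv Fin.revPerm _ _ fun i => Fintype.sum_equiv Fin.revPerm _ _ fun j => ?_
  simp [Fin.rev_lt_rev]

lemma blockAt_rev_conj {N l k p : ℕ} (hk : k ≤ N) (hp : p ≤ N) (σ : Equiv.Perm (Fin (N + l))) :
    Fin.revPerm.trans (σ.trans Fin.revPerm) ∈ blockAt (N + l) l (N - k) (N - p) ↔
      σ ∈ blockAt (N + l) l k p := by
  simp only [blockAt, Set.mem_ofPred_eq]
  rw [← Fin.revPerm.forall_congr_right]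
  refine forall_congr' fun i => ?_
  have h1 := i.isLt
  have h2 := (σ i).isLt
  simp only [Equiv.trans_apply, Fin.revPerm_apply, Fin.rev_rev, Fin.val_rev]
  refine iff_congr ?_ ?_ <;> omega

/-- Reversing both positions and values preserves `inv` and exchanges the values below the block
with those above it. -/
lemma prob_clusterEvent_symm (q : ℝ) (A B : ℕ) {l : ℕ} (hl : 0 < l) :
    prob (A + B + l) q (clusterEvent (A + B + l) l (B + 1))
      = prob (B + A + l) q (clusterEvent (B + A + l) l (A + 1)) := by
  rw [add_comm B A, prob_clusterEvent_eq_sum q B hl, prob_clusterEvent_eq_sum q A hl,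
    ← Finset.Nat.sum_antidiagonal_swap]
  congr 1
  refine Finset.sum_congr rfl fun x hx => ?_
  rw [Finset.HasAntidiagonal.mem_antidiagonal] at hx
  have hbij : Function.Bijective
      fun σ : Equiv.Perm (Fin (A + B + l)) => Fin.revPerm.trans (σ.trans Fin.revPerm) :=
    Function.Involutive.bijective fun σ => by ext; simp
  rw [blockWeight, blockWeight, ← hbij.sum_comp]
  refine Finset.sum_congr rfl fun σ _ => ?_
  have h := blockAt_rev_conj (N := A + B) (l := l) (k := A) (p := x.1) (by omega) (by omega) σ
  rw [show A + B - A = B by omega, show A + B - x.1 = x.2 by omega] at h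
  classical
  simp only [Set.indicator_apply, Prod.fst_swap, inv_rev_conj]
  exact if_congr h rfl rfl

/-! ### Survival of the block: harmonic function and comparison -/

/-- The product `(1 - q ^ (r + 1)) ⋯ (1 - q ^ (r + m))`. -/
noncomputable def qPoch (q : ℝ) (m r : ℕ) : ℝ := ∏ i ∈ Finset.range m, (1 - q ^ (r + 1 + i))

lemma qPoch_shift (q : ℝ) (m r : ℕ) :
    (1 - q ^ (r + 1)) * qPoch q m (r + 1) = qPoch q m r * (1 - q ^ (r + 1 + m)) := by
  have h := Finset.prod_range_succ' (fun i => 1 - q ^ (r + 1 + i)) m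
  rw [Finset.prod_range_succ] at h
  rw [qPoch, qPoch, h, mul_comm, add_zero]
  congr 1
  refine Finset.prod_congr rfl fun i _ => ?_
  congr 2
  ring

lemma qPoch_nonneg {q : ℝ} (h0 : 0 ≤ q) (h1 : q ≤ 1) (m r : ℕ) : 0 ≤ qPoch q m r :=
  Finset.prod_nonneg fun _ _ => sub_nonneg.2 (pow_le_one₀ h0 h1)

lemma qPoch_le_one {q : ℝ} (h0 : 0 ≤ q) (h1 : q ≤ 1) (m r : ℕ) : qPoch q m r ≤ 1 :=
  Finset.prod_le_one (fun _ _ => sub_nonneg.2 (pow_le_one₀ h0 h1))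
    fun _ _ => sub_le_self _ (pow_nonneg h0 _)

lemma one_sub_le_qPoch {q : ℝ} (h0 : 0 ≤ q) (h1 : q ≤ 1) (m r : ℕ) :
    1 - m * q ^ r ≤ qPoch q m r := by
  induction m with
  | zero => simp [qPoch]
  | succ m ih =>
    have hs : qPoch q (m + 1) r = qPoch q m r * (1 - q ^ (r + 1 + m)) :=
      Finset.prod_range_succ _ _
    have hle : q ^ (r + 1 + m) ≤ q ^ r := pow_le_pow_of_le_one h0 h1 (by omega)
    have hp := pow_nonneg h0 (r + 1 + m)
    have h2 := qPoch_le_one h0 h1 m r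
    rw [hs]
    push_cast
    nlinarith

lemma qInt_mul_qPoch_succ {q : ℝ} (hq : q ≠ 1) (m r : ℕ) :
    qInt q (r + 1) * qPoch q m (r + 1) = qInt q (r + (m + 1)) * qPoch q m r := by
  have h : (1 - q) ≠ 0 := sub_ne_zero.2 hq.symm
  apply mul_left_cancel₀ h
  have := qPoch_shift q m r
  rw [← qInt_mul_one_sub, ← qInt_mul_one_sub, show r + 1 + m = r + (m + 1) by ring] at this
  linarith

/-- `[n + 1] ⋯ [n + j]`. -/
noncomputable def qRising (q : ℝ) (j n : ℕ) : ℝ := ∏ i ∈ Finset.range j, qInt q (n + 1 + i)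

lemma qRising_succ (q : ℝ) (j n : ℕ) :
    qRising q (j + 1) n = qInt q (n + 1) * qRising q j (n + 1) := by
  rw [qRising, Finset.prod_range_succ', mul_comm, qRising]
  congr 1
  refine Finset.prod_congr rfl fun i _ => ?_
  congr 1
  ring

lemma qRising_nonneg {q : ℝ} (h0 : 0 ≤ q) (j n : ℕ) : 0 ≤ qRising q j n :=
  Finset.prod_nonneg fun _ _ => qInt_nonneg h0 _

lemma qFact_mul_qRising (q : ℝ) (j n : ℕ) : qFact q n * qRising q j n = qFact q (n + j) := by
  rw [qFact, qFact, qRising, Finset.prod_range_add]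
  congr 1
  refine Finset.prod_congr rfl fun i _ => ?_
  congr 1
  ring

/-- `qPoch` satisfies the recursion with equality: [r+1] h(r+1) = [r+m+1] h(r), and [r+m+1] +
q^(r+m+1) [p+1] is the weight of all gaps. Only the terminal value is an inequality, h ≤ 1. -/
lemma le_insertions {q : ℝ} (h0 : 0 ≤ q) (h1 : q < 1) (m j p r : ℕ) :
    qPoch q m r * qRising q j (p + r + (m + 1)) ≤ insertions q (m + 1) j p r := by
  induction j generalizing p r with
  | zero => simpa [qRising, insertions] using qPoch_le_one h0 h1.le m r
  | succ j ih =>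
    have e1 := ih p (r + 1)
    have e2 := ih (p + 1) r
    rw [show p + (r + 1) + (m + 1) = p + r + (m + 1) + 1 by ring] at e1
    rw [show p + 1 + r + (m + 1) = p + r + (m + 1) + 1 by ring] at e2
    rw [qRising_succ, insertions]
    refine le_trans (le_of_eq ?_) (add_le_add (mul_le_mul_of_nonneg_left e1 (qInt_nonneg h0 _))
      (mul_le_mul_of_nonneg_left e2 (mul_nonneg (pow_nonneg h0 _) (qInt_nonneg h0 _))))
    have h := qInt_mul_qPoch_succ h1.ne m r
    have h' := qInt_add q (r + (m + 1)) (p + 1)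
    rw [← mul_assoc (qInt q (r + 1)), h,
      show p + r + (m + 1) + 1 = r + (m + 1) + (p + 1) by ring, h']
    ring

lemma qInt_succ_add_le {q : ℝ} (h0 : 0 ≤ q) (m p r : ℕ) :
    qInt q (r + 1) + q ^ (r + (m + 1)) * qInt q (p + 1) ≤ qInt q (p + r + (m + 1) + 1) := by
  rw [show p + r + (m + 1) + 1 = r + 1 + m + (p + 1) by ring, qInt_add q (r + 1 + m),
    qInt_add q (r + 1), show r + (m + 1) = r + 1 + m by ring]
  have := mul_nonneg (pow_nonneg h0 (r + 1)) (qInt_nonneg h0 m)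
  linarith

lemma insertions_le {q : ℝ} (h0 : 0 ≤ q) (m j p r : ℕ) :
    insertions q (m + 1) j p r ≤ qRising q j (p + r + (m + 1)) := by
  induction j generalizing p r with
  | zero => simp [qRising, insertions]
  | succ j ih =>
    have e1 := ih p (r + 1)
    have e2 := ih (p + 1) r
    rw [show p + (r + 1) + (m + 1) = p + r + (m + 1) + 1 by ring] at e1
    rw [show p + 1 + r + (m + 1) = p + r + (m + 1) + 1 by ring] at e2
    rw [qRising_succ, insertions]
    refine (add_le_add (mul_le_mul_of_nonneg_left e1 (qInt_nonneg h0 _))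
      (mul_le_mul_of_nonneg_left e2 (mul_nonneg (pow_nonneg h0 _) (qInt_nonneg h0 _)))).trans ?_
    rw [← add_mul]
    exact mul_le_mul_of_nonneg_right (qInt_succ_add_le h0 m p r) (qRising_nonneg h0 _ _)

/-- This is a supermartingale estimate: on surviving insertions q^r shrinks on average by a factor
q. Insertions on the left leave r fixed and would violate this, but the forbidden gaps inside the
block compensate; this needs m ≥ 1. -/
lemma qInt_succ_mul_add_le {q : ℝ} (h0 : 0 ≤ q) (h1 : q ≤ 1) {m : ℕ} (hm : 1 ≤ m) (p r : ℕ) :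
    qInt q (r + 1) * q + q ^ (r + (m + 1)) * qInt q (p + 1)
      ≤ q * qInt q (p + r + (m + 1) + 1) := by
  obtain ⟨m, rfl⟩ : ∃ m', m = m' + 1 := ⟨m - 1, by omega⟩
  rw [show p + r + (m + 1 + 1) + 1 = r + 1 + (m + 1) + (p + 1) by ring,
    qInt_add q (r + 1 + (m + 1)), qInt_add q (r + 1)]
  have h2 : q ^ (r + 2) * q ^ m ≤ q ^ (r + 2) * qInt q (m + 1) := by
    refine mul_le_mul_of_nonneg_left ?_ (pow_nonneg h0 _)
    exact (pow_le_one₀ h0 h1).trans (one_le_qInt_succ h0 m)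
  have h3 := qInt_mul_one_sub q (p + 1)
  have h4 : q ^ (r + (m + 1 + 1)) * (qInt q (p + 1) * (1 - q)) ≤ q ^ (r + (m + 1 + 1)) := by
    refine mul_le_of_le_one_right (pow_nonneg h0 _) ?_
    rw [h3]
    exact sub_le_self _ (pow_nonneg h0 _)
  have h5 : q ^ (r + (m + 1 + 1)) = q ^ (r + 2) * q ^ m := by ring
  have h6 : q ^ (r + 1 + (m + 1)) = q ^ (r + 2) * q ^ m := by ring
  have h7 : q * q ^ (r + 1) = q ^ (r + 2) := by ring
  rw [h5] at h4 ⊢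
  rw [h6, mul_add, mul_add, ← mul_assoc q (q ^ (r + 1)), h7]
  linarith

/-- At the end 1 - h(r) ≤ m q^r, and the error q^r picks up a factor q with each of the j
insertions. -/
lemma insertions_le_add {q : ℝ} (h0 : 0 ≤ q) (h1 : q < 1) {m : ℕ} (hm : 1 ≤ m) (j p r : ℕ) :
    insertions q (m + 1) j p r
      ≤ (qPoch q m r + m * q ^ (r + j)) * qRising q j (p + r + (m + 1)) := by
  induction j generalizing p r with
  | zero =>
    have := one_sub_le_qPoch h0 h1.le m r
    simp only [insertions, qRising, Finset.range_zero, Finset.prod_empty, add_zero]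
    linarith
  | succ j ih =>
    have e1 := ih p (r + 1)
    have e2 := ih (p + 1) r
    rw [show p + (r + 1) + (m + 1) = p + r + (m + 1) + 1 by ring] at e1
    rw [show p + 1 + r + (m + 1) = p + r + (m + 1) + 1 by ring] at e2
    rw [qRising_succ, insertions]
    refine (add_le_add (mul_le_mul_of_nonneg_left e1 (qInt_nonneg h0 _))
      (mul_le_mul_of_nonneg_left e2
        (mul_nonneg (pow_nonneg h0 _) (qInt_nonneg h0 _)))).trans ?_
    have h := qInt_mul_qPoch_succ h1.ne m r
    have h' := qInt_add q (r + (m + 1)) (p + 1)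
    rw [show r + (m + 1) + (p + 1) = p + r + (m + 1) + 1 by ring] at h'
    have h2 := mul_le_mul_of_nonneg_left (qInt_succ_mul_add_le h0 h1.le hm p r)
      (mul_nonneg (Nat.cast_nonneg (α := ℝ) m) (pow_nonneg h0 (r + j)))
    rw [← mul_assoc, ← mul_assoc, ← mul_assoc, ← add_mul]
    refine mul_le_mul_of_nonneg_right ?_ (qRising_nonneg h0 _ _)
    rw [show r + 1 + j = r + j + 1 by ring, ← add_assoc r j 1, pow_succ]
    have h3 : qInt q (p + r + (m + 1) + 1) * qPoch q m r = qInt q (r + 1) * qPoch q m (r + 1)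
      + q ^ (r + (m + 1)) * qInt q (p + 1) * qPoch q m r := by rw [h, h']; ring
    linarith

/-! ### The q-beta sum -/

/-- The closed form of the `q`-beta sum `∑ b, z ^ b * qPoch q m b`. -/
noncomputable def qBeta (q : ℝ) : ℕ → ℝ → ℝ
  | 0, z => (1 - z)⁻¹
  | m + 1, z => (1 - q ^ (m + 1)) * (1 - z)⁻¹ * qBeta q m (q * z)

lemma summable_qPoch {q z : ℝ} (h0 : 0 ≤ q) (h1 : q ≤ 1) (hz0 : 0 ≤ z) (hz1 : z < 1) (m : ℕ) :
    Summable fun b => z ^ b * qPoch q m b :=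
  Summable.of_nonneg_of_le (fun b => mul_nonneg (pow_nonneg hz0 _) (qPoch_nonneg h0 h1 m b))
    (fun b => mul_le_of_le_one_right (pow_nonneg hz0 _) (qPoch_le_one h0 h1 m b))
    (summable_geometric_of_lt_one hz0 hz1)

lemma qPoch_succ_succ_sub (q : ℝ) (m b : ℕ) :
    qPoch q (m + 1) (b + 1) - qPoch q (m + 1) b
      = (1 - q ^ (m + 1)) * (q ^ (b + 1) * qPoch q m (b + 1)) := by
  have h1 : qPoch q (m + 1) (b + 1) = qPoch q m (b + 1) * (1 - q ^ (b + 1 + 1 + m)) :=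
    Finset.prod_range_succ _ _
  have h2 : qPoch q (m + 1) b = (1 - q ^ (b + 1)) * qPoch q m (b + 1) := by
    rw [qPoch_shift]
    exact Finset.prod_range_succ _ _
  rw [h1, h2]
  ring

/-- Summation by parts: multiplying the series by 1 - z replaces the product by its differences,
which are shorter products weighted by q^(b+1), so z becomes q z. -/
lemma tsum_qPoch {q z : ℝ} (h0 : 0 ≤ q) (h1 : q ≤ 1) (hz0 : 0 ≤ z) (hz1 : z < 1) (m : ℕ) :
    ∑' b, z ^ b * qPoch q m b = qBeta q m z := by
  induction m generalizing z with
  | zero => simp [qPoch, qBeta, tsum_geometric_of_lt_one hz0 hz1]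
  | succ m ih =>
    have hs := summable_qPoch h0 h1 hz0 hz1 (m + 1)
    have hqz : q * z < 1 := (mul_le_of_le_one_left hz0 h1).trans_lt hz1
    have hqz0 : 0 ≤ q * z := mul_nonneg h0 hz0
    have hs' := summable_qPoch h0 h1 hqz0 hqz m
    rw [qBeta, ← ih hqz0 hqz, hs'.tsum_eq_zero_add]
    have e := hs.tsum_eq_zero_add
    have e2 : ∑' b, z ^ (b + 1) * qPoch q (m + 1) (b + 1)
        = z * ∑' b, z ^ b * qPoch q (m + 1) b
          + (1 - q ^ (m + 1)) * ∑' b, (q * z) ^ (b + 1) * qPoch q m (b + 1) := by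
      rw [← tsum_mul_left, ← tsum_mul_left, ← (hs.mul_left z).tsum_add
        (((summable_nat_add_iff 1).2 hs').mul_left _)]
      refine tsum_congr fun b => ?_
      have := qPoch_succ_succ_sub q m b
      rw [sub_eq_iff_eq_add] at this
      rw [this, mul_pow]
      ring
    have e3 : qPoch q (m + 1) 0 = qPoch q m 0 * (1 - q ^ (m + 1)) := by
      rw [qPoch, Finset.prod_range_succ, qPoch, zero_add, add_comm 1 m]
    have hne : 1 - z ≠ 0 := (sub_pos.2 hz1).ne'
    rw [e2, e3] at e
    rw [mul_right_comm, ← div_eq_mul_inv, eq_div_iff hne]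
    linarith

/-- At a power of q every factor of the closed form is 1 - q times a q-integer; one more such factor
occurs in the denominator than in the numerator. -/
lemma qBeta_eq {q : ℝ} (h0 : 0 ≤ q) (h1 : q < 1) (m l : ℕ) :
    (1 - q) * qBeta q m (q ^ (l + 1)) = qFact q m / qRising q (m + 1) l := by
  have hq : 1 - q ≠ 0 := (sub_pos.2 h1).ne'
  have hpos : ∀ n, qInt q (n + 1) ≠ 0 := fun n => (one_pos.trans_le (one_le_qInt_succ h0 n)).ne'
  induction m generalizing l with
  | zero =>
    have := hpos l
    simp only [qBeta, qFact, qRising, Finset.range_zero, Finset.prod_empty, zero_add,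
      Finset.range_one, Finset.prod_singleton, add_zero]
    rw [← qInt_mul_one_sub]
    field_simp
  | succ m ih =>
    have := hpos l
    rw [qBeta, qRising_succ, qFact_succ, ← pow_succ', ← qInt_mul_one_sub, ← qInt_mul_one_sub]
    calc _ = qInt q (m + 1) / qInt q (l + 1) * ((1 - q) * qBeta q m (q ^ (l + 1 + 1))) := by
          field_simp
      _ = _ := by
          rw [ih]
          ring

/-! ### Bounds on the cluster probability for fixed n -/

lemma prob_prefactor {q : ℝ} (h0 : 0 < q) (A B l : ℕ) :
    qFact q B * qFact q l / qFact q (B + A + l) * qRising q A (B + l)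
      = qFact q l / qRising q l B := by
  have hB := (qFact_pos h0.le B).ne'
  have hBl := qFact_pos h0.le (B + l)
  have hR : qRising q l B ≠ 0 := by
    intro h
    rw [← qFact_mul_qRising, h, mul_zero] at hBl
    exact hBl.false
  have hn := (qFact_pos h0.le (B + l + A)).ne'
  have e1 := qFact_mul_qRising q A (B + l)
  have e2 := qFact_mul_qRising q l B
  rw [show B + A + l = B + l + A by ring, div_mul_eq_mul_div, div_eq_div_iff hn hR, ← e1, ← e2]
  ring

/-- This shows that the denominator left by `prob_prefactor` is (1 - q)^(-l) up to a factor close to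
1 when q^B is small. -/
lemma one_sub_mul_qRising_le {q : ℝ} (h0 : 0 ≤ q) (h1 : q ≤ 1) (l B : ℕ) :
    (1 - q) ^ l * qRising q l B ≤ 1 ∧ (1 - q ^ B) ^ l ≤ (1 - q) ^ l * qRising q l B := by
  have h : (1 - q) ^ l * qRising q l B = ∏ i ∈ Finset.range l, (1 - q ^ (B + 1 + i)) := by
    have hc : (1 - q) ^ l = ∏ _i ∈ Finset.range l, (1 - q) := by simp
    rw [qRising, hc, ← Finset.prod_mul_distrib]
    refine Finset.prod_congr rfl fun i _ => ?_
    rw [mul_comm, qInt_mul_one_sub]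
  rw [h]
  refine ⟨qPoch_le_one h0 h1 l B, ?_⟩
  have hc : (1 - q ^ B) ^ l = ∏ _i ∈ Finset.range l, (1 - q ^ B) := by simp
  rw [hc]
  refine Finset.prod_le_prod (fun _ _ => sub_nonneg.2 (pow_le_one₀ h0 h1)) fun i _ => ?_
  exact sub_le_sub_left (pow_le_pow_of_le_one h0 h1 (by omega)) _

lemma qRising_pos {q : ℝ} (h0 : 0 ≤ q) (j n : ℕ) : 0 < qRising q j n :=
  Finset.prod_pos fun i _ => by
    rw [add_right_comm]
    exact one_pos.trans_le (one_le_qInt_succ h0 _)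

lemma sum_geom_le {q : ℝ} (h0 : 0 ≤ q) (l N : ℕ) :
    (∑ b ∈ Finset.range N, q ^ ((l + 1) * b)) * (qInt q (l + 1) * (1 - q)) ≤ 1 := by
  simp only [pow_mul]
  rw [qInt_mul_one_sub, geom_sum_mul_neg]
  exact sub_le_self _ (pow_nonneg (pow_nonneg h0 _) _)

lemma sum_geom_le' {q : ℝ} (h0 : 0 ≤ q) (h1 : q < 1) (l N : ℕ) :
    (∑ b ∈ Finset.range N, q ^ ((l + 1) * b)) * (1 - q) ≤ 1 := by
  refine le_trans ?_ (sum_geom_le h0 l N)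
  refine mul_le_mul_of_nonneg_left ?_ (Finset.sum_nonneg fun _ _ => pow_nonneg h0 _)
  exact le_mul_of_one_le_left (sub_nonneg.2 h1.le) (one_le_qInt_succ h0 l)

/-- The tail beyond N is dominated by a geometric series, which costs at most q^N. -/
lemma sum_qPoch_bounds {q : ℝ} (h0 : 0 < q) (h1 : q < 1) (m N : ℕ) :
    qFact q m / qRising q (m + 1) m - q ^ N
        ≤ (1 - q) * ∑ b ∈ Finset.range N, q ^ ((m + 1) * b) * qPoch q m b ∧
      (1 - q) * ∑ b ∈ Finset.range N, q ^ ((m + 1) * b) * qPoch q m b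
        ≤ qFact q m / qRising q (m + 1) m := by
  have hz0 : 0 ≤ q ^ (m + 1) := pow_nonneg h0.le _
  have hz1 : q ^ (m + 1) < 1 := pow_lt_one₀ h0.le h1 (by omega)
  have hs := summable_qPoch h0.le h1.le hz0 hz1 m
  have hsplit := hs.sum_add_tsum_nat_add N
  have hs2 : Summable fun b => (q ^ (m + 1)) ^ (b + N) :=
    (summable_nat_add_iff N).2 (summable_geometric_of_lt_one hz0 hz1)
  have htail0 : 0 ≤ ∑' b, (q ^ (m + 1)) ^ (b + N) * qPoch q m (b + N) :=
    tsum_nonneg fun b => mul_nonneg (pow_nonneg hz0 _) (qPoch_nonneg h0.le h1.le _ _)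
  have htail : ∑' b, (q ^ (m + 1)) ^ (b + N) * qPoch q m (b + N)
      ≤ (1 - q ^ (m + 1))⁻¹ * (q ^ (m + 1)) ^ N := by
    rw [← tsum_geometric_of_lt_one hz0 hz1, ← tsum_mul_right]
    simp only [← pow_add]
    exact ((summable_nat_add_iff N).2 hs).tsum_le_tsum
      (fun b => mul_le_of_le_one_right (pow_nonneg hz0 _) (qPoch_le_one h0.le h1.le _ _)) hs2
  have hh : 0 < 1 - q := sub_pos.2 h1
  have htail' : (1 - q) * ((1 - q ^ (m + 1))⁻¹ * (q ^ (m + 1)) ^ N) ≤ q ^ N := by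
    have h2 : (q ^ (m + 1)) ^ N ≤ q ^ N := by
      refine pow_le_pow_left₀ hz0 ?_ N
      exact pow_le_of_le_one h0.le h1.le (by omega)
    have h3 : (1 - q) * (1 - q ^ (m + 1))⁻¹ ≤ 1 := by
      rw [← div_eq_mul_inv, div_le_one (sub_pos.2 hz1)]
      exact sub_le_sub_left (pow_le_of_le_one h0.le h1.le (by omega)) _
    rw [← mul_assoc]
    exact (mul_le_of_le_one_left (pow_nonneg hz0 _) h3).trans h2
  rw [tsum_qPoch h0.le h1.le hz0 hz1] at hsplit
  rw [← qBeta_eq h0.le h1, ← hsplit]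
  simp only [pow_mul, mul_add]
  have := mul_nonneg hh.le htail0
  have := mul_le_mul_of_nonneg_left htail hh.le
  constructor <;> linarith

lemma qFact_mul_le_prob {q : ℝ} (h0 : 0 < q) (h1 : q < 1) (A B m : ℕ) :
    (1 - q) ^ m * (qFact q (m + 1) * (qFact q m / qRising q (m + 1) m - q ^ (B + 1)))
      ≤ prob (A + B + (m + 1)) q (clusterEvent (A + B + (m + 1)) (m + 1) (B + 1)) := by
  rw [prob_clusterEvent_eq q A B m.succ_pos]
  have hC : (0 : ℝ) ≤ qFact q B * qFact q (m + 1) / qFact q (B + A + (m + 1)) :=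
    div_nonneg (mul_pos (qFact_pos h0.le _) (qFact_pos h0.le _)).le (qFact_pos h0.le _).le
  have hpre := prob_prefactor h0 A B (m + 1)
  set C := qFact q B * qFact q (m + 1) / qFact q (B + A + (m + 1)) with hCdef
  have hsum : (∑ b ∈ Finset.range (B + 1), q ^ ((m + 1) * b) * qPoch q m b)
      * qRising q A (B + (m + 1))
      ≤ ∑ b ∈ Finset.range (B + 1), q ^ ((m + 1) * b) * insertions q (m + 1) A (B - b) b := by
    rw [Finset.sum_mul]
    refine Finset.sum_le_sum fun b hb => ?_
    rw [Finset.mem_range] at hb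
    rw [mul_assoc]
    refine mul_le_mul_of_nonneg_left ?_ (pow_nonneg h0.le _)
    have := le_insertions h0.le h1 m A (B - b) b
    rwa [show B - b + b + (m + 1) = B + (m + 1) by omega] at this
  refine le_trans ?_ (mul_le_mul_of_nonneg_right hsum hC)
  rw [mul_assoc, mul_comm _ C, hpre]
  have hS := (sum_qPoch_bounds h0 h1 m (B + 1)).1
  have hS0 : 0 ≤ ∑ b ∈ Finset.range (B + 1), q ^ ((m + 1) * b) * qPoch q m b :=
    Finset.sum_nonneg fun b _ => mul_nonneg (pow_nonneg h0.le _) (qPoch_nonneg h0.le h1.le _ _)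
  set S := ∑ b ∈ Finset.range (B + 1), q ^ ((m + 1) * b) * qPoch q m b
  have hR := qRising_pos h0.le (m + 1) B
  have hh := pow_pos (sub_pos.2 h1) m
  have hF := qFact_pos h0.le (m + 1)
  rw [mul_div_assoc', le_div_iff₀ hR]
  have hle := (one_sub_mul_qRising_le h0.le h1.le (m + 1) B).1
  calc _ ≤ (1 - q) ^ m * (qFact q (m + 1) * ((1 - q) * S)) * qRising q (m + 1) B := by gcongr
    _ = S * qFact q (m + 1) * ((1 - q) ^ (m + 1) * qRising q (m + 1) B) := by ring
    _ ≤ S * qFact q (m + 1) * 1 := by gcongr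
    _ = _ := mul_one _

/-- The common part of both upper bounds, with X a bound on survival. The factor (1 - q^B)^l stays
on the left because it vanishes at B = 0. -/
lemma prob_mul_le_of_insertions_le {q : ℝ} (h0 : 0 < q) (h1 : q < 1) (A B m : ℕ) (X : ℕ → ℝ)
    (hX0 : ∀ b, 0 ≤ X b)
    (hX : ∀ p b, insertions q (m + 1) A p b ≤ X b * qRising q A (p + b + (m + 1))) :
    prob (A + B + (m + 1)) q (clusterEvent (A + B + (m + 1)) (m + 1) (B + 1))
        * (1 - q ^ B) ^ (m + 1)
      ≤ (1 - q) ^ m * (qFact q (m + 1)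
        * ((1 - q) * ∑ b ∈ Finset.range (B + 1), q ^ ((m + 1) * b) * X b)) := by
  rw [prob_clusterEvent_eq q A B m.succ_pos]
  have hC : (0 : ℝ) ≤ qFact q B * qFact q (m + 1) / qFact q (B + A + (m + 1)) :=
    div_nonneg (mul_pos (qFact_pos h0.le _) (qFact_pos h0.le _)).le (qFact_pos h0.le _).le
  have hpre := prob_prefactor h0 A B (m + 1)
  set C := qFact q B * qFact q (m + 1) / qFact q (B + A + (m + 1)) with hCdef
  have hsum : ∑ b ∈ Finset.range (B + 1), q ^ ((m + 1) * b) * insertions q (m + 1) A (B - b) b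
      ≤ (∑ b ∈ Finset.range (B + 1), q ^ ((m + 1) * b) * X b) * qRising q A (B + (m + 1)) := by
    rw [Finset.sum_mul]
    refine Finset.sum_le_sum fun b hb => ?_
    rw [Finset.mem_range] at hb
    rw [mul_assoc]
    refine mul_le_mul_of_nonneg_left ?_ (pow_nonneg h0.le _)
    have := hX (B - b) b
    rwa [show B - b + b + (m + 1) = B + (m + 1) by omega] at this
  have hS0 : 0 ≤ ∑ b ∈ Finset.range (B + 1), q ^ ((m + 1) * b) * X b :=
    Finset.sum_nonneg fun b _ => mul_nonneg (pow_nonneg h0.le _) (hX0 b)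
  set S := ∑ b ∈ Finset.range (B + 1), q ^ ((m + 1) * b) * X b
  have hB : 0 ≤ 1 - q ^ B := sub_nonneg.2 (pow_le_one₀ h0.le h1.le)
  have hR := qRising_pos h0.le (m + 1) B
  have hF := qFact_pos h0.le (m + 1)
  refine (mul_le_mul_of_nonneg_right (mul_le_mul_of_nonneg_right hsum hC)
    (pow_nonneg hB _)).trans ?_
  rw [mul_assoc S, mul_comm _ C, hpre, mul_div_assoc', div_mul_eq_mul_div, div_le_iff₀ hR]
  calc _ ≤ S * qFact q (m + 1) * ((1 - q) ^ (m + 1) * qRising q (m + 1) B) := by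
        gcongr
        exact (one_sub_mul_qRising_le h0.le h1.le (m + 1) B).2
    _ = _ := by ring

lemma prob_mul_le {q : ℝ} (h0 : 0 < q) (h1 : q < 1) (A B m : ℕ) :
    prob (A + B + (m + 1)) q (clusterEvent (A + B + (m + 1)) (m + 1) (B + 1))
        * (1 - q ^ B) ^ (m + 1)
      ≤ (1 - q) ^ m * (qFact q (m + 1) / qInt q (m + 1)) := by
  refine (prob_mul_le_of_insertions_le h0 h1 A B m (fun _ => 1) (fun _ => zero_le_one)
    fun p b => by simpa using insertions_le h0.le m A p b).trans ?_
  have hI := one_pos.trans_le (one_le_qInt_succ h0.le m)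
  have hF := qFact_pos h0.le (m + 1)
  have hh := pow_pos (sub_pos.2 h1) m
  rw [div_eq_mul_inv]
  gcongr
  simp only [mul_one]
  rw [inv_eq_one_div, le_div_iff₀ hI]
  have := sum_geom_le h0.le m (B + 1)
  linarith

lemma prob_mul_le_add {q : ℝ} (h0 : 0 < q) (h1 : q < 1) (A B : ℕ) {m : ℕ} (hm : 1 ≤ m) :
    prob (A + B + (m + 1)) q (clusterEvent (A + B + (m + 1)) (m + 1) (B + 1))
        * (1 - q ^ B) ^ (m + 1)
      ≤ (1 - q) ^ m * (qFact q (m + 1) * (qFact q m / qRising q (m + 1) m + m * q ^ A)) := by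
  refine (prob_mul_le_of_insertions_le h0 h1 A B m (fun b => qPoch q m b + m * q ^ (b + A))
    (fun b => add_nonneg (qPoch_nonneg h0.le h1.le _ _) (by positivity))
    fun p b => insertions_le_add h0.le h1 hm A p b).trans ?_
  have hF := qFact_pos h0.le (m + 1)
  have hh1 := sub_pos.2 h1
  have hh := pow_pos hh1 m
  gcongr
  have e1 := (sum_qPoch_bounds h0 h1 m (B + 1)).2
  have e2 : ∑ b ∈ Finset.range (B + 1), q ^ ((m + 1) * b) * (m * q ^ (b + A))
      ≤ (∑ b ∈ Finset.range (B + 1), q ^ ((m + 1) * b)) * (m * q ^ A) := by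
    rw [Finset.sum_mul]
    refine Finset.sum_le_sum fun b _ => ?_
    gcongr ?_ * (_ * ?_)
    exact pow_le_pow_of_le_one h0.le h1.le (by omega)
  have e3 : (∑ b ∈ Finset.range (B + 1), q ^ ((m + 1) * b)) * (1 - q) * (m * q ^ A)
      ≤ 1 * (m * q ^ A) := by
    gcongr
    exact sum_geom_le' h0.le h1 m (B + 1)
  have e4 := mul_le_mul_of_nonneg_left e2 hh1.le
  simp only [mul_add (q ^ _), Finset.sum_add_distrib]
  rw [mul_add]
  linarith

lemma prob_nonneg {q : ℝ} (h0 : 0 ≤ q) (n : ℕ) (s : Set (Equiv.Perm (Fin n))) :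
    0 ≤ prob n q s := by
  refine Finset.sum_nonneg fun σ _ => Set.indicator_nonneg (fun σ _ => ?_) σ
  rw [Z_eq_qFact]
  exact div_nonneg (pow_nonneg h0 _) (qFact_pos h0 n).le

/-- After a reflection if necessary, at least half of the values outside the block lie below it;
this is the source of uniformity in k. -/
lemma exists_prob_clusterEvent_eq (q : ℝ) {n l k : ℕ} (hl : 0 < l) (hk : 1 ≤ k)
    (hkn : k + l ≤ n + 1) :
    ∃ A B, (n - l) / 2 ≤ B ∧ prob n q (clusterEvent n l k)
      = prob (A + B + l) q (clusterEvent (A + B + l) l (B + 1)) := by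
  obtain ⟨B, rfl⟩ : ∃ B, k = B + 1 := ⟨k - 1, by omega⟩
  obtain ⟨A, rfl⟩ : ∃ A, n = A + B + l := ⟨n - B - l, by omega⟩
  rcases le_total A B with h | h
  · exact ⟨A, B, by omega, rfl⟩
  · exact ⟨B, A, by omega, prob_clusterEvent_symm q A B hl⟩

/-! ### Limits as q tends to 1, and the constants -/

lemma tendsto_qInt {u : ℕ → ℝ} (hu : Tendsto u atTop (𝓝 1)) (i : ℕ) :
    Tendsto (fun n => qInt (u n) i) atTop (𝓝 i) := by
  have h : Continuous fun q => qInt q i := by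
    unfold qInt
    fun_prop
  have h' := (h.tendsto 1).comp hu
  rwa [show qInt 1 i = i by simp [qInt]] at h'

lemma tendsto_qFact {u : ℕ → ℝ} (hu : Tendsto u atTop (𝓝 1)) (m : ℕ) :
    Tendsto (fun n => qFact (u n) m) atTop (𝓝 m.factorial) := by
  rw [← Finset.prod_range_add_one_eq_factorial]
  push_cast
  exact tendsto_finsetProd _ fun i _ => by exact_mod_cast tendsto_qInt hu (i + 1)

lemma tendsto_qRising {u : ℕ → ℝ} (hu : Tendsto u atTop (𝓝 1)) (j m : ℕ) :
    Tendsto (fun n => qRising (u n) j m) atTop (𝓝 (∏ i ∈ Finset.range j, ((m : ℝ) + 1 + i))) :=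
  tendsto_finsetProd _ fun i _ => by exact_mod_cast tendsto_qInt hu (m + 1 + i)

lemma integral_pow_mul_one_sub_pow (m : ℕ) :
    ∫ x in (0 : ℝ)..1, x ^ m * (1 - x) ^ m
      = m.factorial / ∏ i ∈ Finset.range (m + 1), ((m : ℝ) + 1 + i) := by
  have h := Complex.betaIntegral_eval_nat_add_one_right (u := (m : ℂ) + 1)
    (by simp; positivity) m
  rw [Complex.betaIntegral] at h
  simp only [add_sub_cancel_right, Complex.cpow_natCast] at h
  apply Complex.ofReal_injective
  rw [← intervalIntegral.integral_ofReal]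
  push_cast
  exact h

lemma integral_pow_mul_exp_ge (m : ℕ) :
    m.factorial / ∏ i ∈ Finset.range (m + 1), ((m : ℝ) + 1 + i)
      ≤ ∫ x in (0 : ℝ)..1, x ^ m * Real.exp (-(m : ℝ) * x) := by
  rw [← integral_pow_mul_one_sub_pow]
  refine intervalIntegral.integral_mono_on zero_le_one
    (Continuous.intervalIntegrable (by fun_prop) _ _)
    (Continuous.intervalIntegrable (by fun_prop) _ _) fun x hx => ?_
  refine mul_le_mul_of_nonneg_left ?_ (pow_nonneg hx.1 _)
  rw [show -(m : ℝ) * x = m * (-x) by ring, Real.exp_nat_mul]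
  exact pow_le_pow_left₀ (sub_nonneg.2 hx.2) (Real.one_sub_le_exp_neg x) m

/-- The product is (2m+1)!/m!, so the right side is larger by the factor 2m + 2. -/
lemma factorial_div_lt (m : ℕ) :
    (m.factorial : ℝ) ^ 2 / (2 * (m + 1)).factorial
      < m.factorial / ∏ i ∈ Finset.range (m + 1), ((m : ℝ) + 1 + i) := by
  have hprod : (m.factorial : ℝ) * ∏ i ∈ Finset.range (m + 1), ((m : ℝ) + 1 + i)
      = (2 * m + 1).factorial := by
    rw [show 2 * m + 1 = m + (m + 1) by ring, ← Nat.factorial_mul_ascFactorial,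
      Nat.ascFactorial_eq_prod_range]
    push_cast
    rfl
  have hP : 0 < ∏ i ∈ Finset.range (m + 1), ((m : ℝ) + 1 + i) :=
    Finset.prod_pos fun i _ => by positivity
  have hm : (0 : ℝ) < m.factorial := by positivity
  rw [show 2 * (m + 1) = (2 * m + 1) + 1 by ring, Nat.factorial_succ]
  push_cast
  rw [← hprod, div_lt_div_iff₀ (by positivity) hP]
  have : 0 < (m.factorial : ℝ) ^ 2 * ∏ i ∈ Finset.range (m + 1), ((m : ℝ) + 1 + i) := by positivity
  nlinarith [(Nat.cast_nonneg m : (0 : ℝ) ≤ m)]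

lemma tendsto_natCast_rpow {α : ℝ} (hα : 0 < α) :
    Tendsto (fun n : ℕ => (n : ℝ) ^ α) atTop atTop :=
  (tendsto_rpow_atTop hα).comp tendsto_natCast_atTop_atTop

/-- From 1 - t ≤ e^(-t), q^x ≤ exp(-c x / n^α). -/
lemma tendsto_pow_zero {c α : ℝ} (hc : 0 < c) {q : ℕ → ℝ}
    (hq : ∀ n, q n = 1 - c / (n : ℝ) ^ α) (hq0 : ∀ᶠ n in atTop, 0 < q n) {x : ℕ → ℕ}
    (hx : Tendsto (fun n => (x n : ℝ) / (n : ℝ) ^ α) atTop atTop) :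
    Tendsto (fun n => q n ^ x n) atTop (𝓝 0) := by
  have h := Real.tendsto_exp_neg_atTop_nhds_zero.comp (hx.const_mul_atTop hc)
  refine squeeze_zero' (hq0.mono fun n hn => pow_nonneg hn.le _) ?_ h
  filter_upwards [hq0] with n hn
  have e : Real.exp (-(c * ((x n : ℝ) / (n : ℝ) ^ α))) = Real.exp (-(c / (n : ℝ) ^ α)) ^ x n := by
    rw [← Real.exp_nat_mul]
    congr 1
    ring
  simp only [Function.comp_apply]
  rw [e]
  refine pow_le_pow_left₀ hn.le ?_ _
  rw [hq]
  exact Real.one_sub_le_exp_neg _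

lemma tendsto_half_sub_div_rpow {α : ℝ} (hα : α < 1) (l : ℕ) :
    Tendsto (fun n : ℕ => (((n - l) / 2 : ℕ) : ℝ) / (n : ℝ) ^ α) atTop atTop := by
  have h := (tendsto_natCast_rpow (sub_pos.2 hα)).atTop_div_const (show (0 : ℝ) < 4 by norm_num)
  refine tendsto_atTop_mono' _ ?_ h
  filter_upwards [eventually_ge_atTop (2 * l + 4)] with n hn
  have hn0 : (0 : ℝ) < n := by exact_mod_cast (by omega : 0 < n)
  have h1 : n ≤ 4 * ((n - l) / 2) := by omega
  have h2 : (n : ℝ) ≤ 4 * (((n - l) / 2 : ℕ) : ℝ) := by exact_mod_cast h1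
  rw [Real.rpow_sub hn0, Real.rpow_one, div_right_comm]
  have := Real.rpow_pos_of_pos hn0 α
  gcongr
  linarith

end Mallows

/-! ### Assembly of the asymptotic bounds -/

theorem theorem1 (l : ℕ) (hl : 2 ≤ l) (c α : ℝ) (hc : 0 < c) (hα0 : 0 < α) (hα1 : α < 1)
    (q : ℕ → ℝ) (hq : ∀ n, q n = 1 - c / (n : ℝ) ^ α)
    (r : ℕ → ℝ)
    (hr : ∀ n, r n = c ^ (l - 1) * (l.factorial : ℝ) / (n : ℝ) ^ (α * ((l : ℝ) - 1))) :
    (Mallows.UniformAsympLE (fun n => {k | 1 ≤ k ∧ k + l ≤ n + 1})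
        (fun n _ => ((l - 1).factorial : ℝ) ^ 2 / ((2 * l).factorial : ℝ) * r n)
        (fun n k => Mallows.prob n (q n) (Mallows.clusterEvent n l k)) ∧
      Mallows.UniformAsympLE (fun n => {k | 1 ≤ k ∧ k + l ≤ n + 1})
        (fun n k => Mallows.prob n (q n) (Mallows.clusterEvent n l k))
        (fun n _ => 1 / (l : ℝ) * r n)) ∧
    (∀ k : ℕ → ℕ,
      Tendsto (fun n : ℕ => min (k n : ℝ) ((n : ℝ) - (k n : ℝ)) / (n : ℝ) ^ α) atTop atTop →
      Mallows.AsympLE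
        (fun n => ((l - 1).factorial : ℝ) ^ 2 / ((2 * l).factorial : ℝ) * r n)
        (fun n => Mallows.prob n (q n) (Mallows.clusterEvent n l (k n))) ∧
      Mallows.AsympLE
        (fun n => Mallows.prob n (q n) (Mallows.clusterEvent n l (k n)))
        (fun n => (∫ x in (0 : ℝ)..1, x ^ (l - 1) * Real.exp (-((l : ℝ) - 1) * x)) * r n)) := by
  obtain ⟨m, rfl⟩ : ∃ m, l = m + 1 := ⟨l - 1, by omega⟩
  have hm : 1 ≤ m := by omega
  have hm1 : ((m + 1 : ℕ) : ℝ) - 1 = m := by push_cast; ring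
  simp only [add_tsub_cancel_right, hm1] at hr ⊢
  have hpow := Mallows.tendsto_natCast_rpow hα0
  have hh : Tendsto (fun n : ℕ => c / (n : ℝ) ^ α) atTop (𝓝 0) := hpow.const_div_atTop c
  have hq1 : Tendsto q atTop (𝓝 1) := by
    rw [funext hq]
    simpa using hh.const_sub 1
  have hq0 : ∀ᶠ n in atTop, 0 < q n := hq1.eventually_const_lt one_pos
  have hqlt : ∀ᶠ n in atTop, q n < 1 := by
    filter_upwards [eventually_gt_atTop 0] with n hn
    rw [hq, sub_lt_self_iff]
    have : (0 : ℝ) < n := by exact_mod_cast hn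
    positivity
  -- The finite bounds carry the factor (1 - q)^m, so powers of n play no further role.
  have hr' : ∀ n, r n = (1 - q n) ^ m * (m + 1).factorial := by
    intro n
    rw [hr, hq, Real.rpow_mul_natCast n.cast_nonneg, sub_sub_cancel, div_pow]
    ring
  have hF := Mallows.tendsto_qFact hq1 (m + 1)
  have hβ := (Mallows.tendsto_qFact hq1 m).div (Mallows.tendsto_qRising hq1 (m + 1) m)
    (Finset.prod_pos fun i _ => by positivity).ne'
  have hfac : (0 : ℝ) < (m + 1).factorial := by positivity
  set β : ℝ := m.factorial / ∏ i ∈ Finset.range (m + 1), ((m : ℝ) + 1 + i) with hβdef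
  have hβ0 : 0 < β := div_pos (by positivity) (Finset.prod_pos fun i _ => by positivity)
  have he := Mallows.tendsto_pow_zero hc hq hq0 (Mallows.tendsto_half_sub_div_rpow hα1 (m + 1))
  have hlower : Mallows.UniformAsympLE (fun n => {k | 1 ≤ k ∧ k + (m + 1) ≤ n + 1})
      (fun n _ => (m.factorial : ℝ) ^ 2 / ((2 * (m + 1)).factorial : ℝ) * r n)
      (fun n k => Mallows.prob n (q n) (Mallows.clusterEvent n (m + 1) k)) := by
    intro ε hε
    have hlim := ((hF.mul (hβ.sub he)).const_mul (1 + ε))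
    have hlt : (m.factorial : ℝ) ^ 2 / ((2 * (m + 1)).factorial : ℝ) * (m + 1).factorial
        < (1 + ε) * ((m + 1).factorial * (β - 0)) := by
      have h1 := mul_lt_mul_of_pos_right (Mallows.factorial_div_lt m) hfac
      have h2 : 0 < ε * ((m + 1).factorial * β) := by positivity
      linarith
    filter_upwards [hlim.eventually_const_lt hlt, hq0, hqlt] with n hn h0 h1 k hk
    obtain ⟨A, B, hB, hP⟩ := Mallows.exists_prob_clusterEvent_eq (q n) m.succ_pos hk.1 hk.2
    have hb := Mallows.qFact_mul_le_prob h0 h1 A B m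
    rw [← hP] at hb
    have hle : q n ^ (B + 1) ≤ q n ^ ((n - (m + 1)) / 2) :=
      pow_le_pow_of_le_one h0.le h1.le (by omega)
    have hF0 := Mallows.qFact_pos h0.le (m + 1)
    have hh0 : 0 ≤ (1 - q n) ^ m := pow_nonneg (sub_pos.2 h1).le _
    simp only [Pi.div_apply] at hn
    rw [hr']
    calc _ = (1 - q n) ^ m * ((m.factorial : ℝ) ^ 2 / ((2 * (m + 1)).factorial : ℝ)
          * (m + 1).factorial) := by ring
      _ ≤ (1 - q n) ^ m * ((1 + ε) * (Mallows.qFact (q n) (m + 1)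
          * (Mallows.qFact (q n) m / Mallows.qRising (q n) (m + 1) m - q n ^ ((n - (m + 1)) / 2)))) := by gcongr
      _ ≤ (1 - q n) ^ m * ((1 + ε) * (Mallows.qFact (q n) (m + 1)
          * (Mallows.qFact (q n) m / Mallows.qRising (q n) (m + 1) m - q n ^ (B + 1)))) := by gcongr
      _ = (1 + ε) * ((1 - q n) ^ m * (Mallows.qFact (q n) (m + 1)
          * (Mallows.qFact (q n) m / Mallows.qRising (q n) (m + 1) m - q n ^ (B + 1)))) := by ring
      _ ≤ _ := by gcongr
  refine ⟨⟨hlower, fun ε hε => ?_⟩, fun k hk => ?_⟩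
  · have hl0 : ((m + 1 : ℕ) : ℝ) ≠ 0 := by positivity
    have hlim1 := hF.div (Mallows.tendsto_qInt hq1 (m + 1)) hl0
    have hlim2 := ((he.const_sub 1).pow (m + 1)).const_mul
      ((1 + ε) * (1 / ((m + 1 : ℕ) : ℝ) * (m + 1).factorial))
    have hlt : ((m + 1).factorial : ℝ) / ((m + 1 : ℕ) : ℝ)
        < (1 + ε) * (1 / ((m + 1 : ℕ) : ℝ) * (m + 1).factorial) * (1 - 0) ^ (m + 1) := by
      rw [sub_zero, one_pow, mul_one, one_div, inv_mul_eq_div]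
      exact lt_mul_of_one_lt_left (by positivity) (by linarith)
    filter_upwards [hlim1.eventually_lt hlim2 hlt, he.eventually_lt_const one_pos, hq0, hqlt]
      with n hn he1 h0 h1 k hk
    obtain ⟨A, B, hB, hP⟩ := Mallows.exists_prob_clusterEvent_eq (q n) m.succ_pos hk.1 hk.2
    have hb := Mallows.prob_mul_le h0 h1 A B m
    rw [← hP] at hb
    have hle : q n ^ B ≤ q n ^ ((n - (m + 1)) / 2) := pow_le_pow_of_le_one h0.le h1.le hB
    have hP0 := Mallows.prob_nonneg h0.le n (Mallows.clusterEvent n (m + 1) k)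
    have hh0 : 0 ≤ (1 - q n) ^ m := pow_nonneg (sub_pos.2 h1).le _
    have hpos : 0 < (1 - q n ^ ((n - (m + 1)) / 2)) ^ (m + 1) := pow_pos (sub_pos.2 he1) _
    rw [hr']
    -- Multiplying by this k-independent factor, which tends to 1, matches the left side of
    -- `prob_mul_le` uniformly in k.
    refine le_of_mul_le_mul_right ?_ hpos
    simp only [Pi.div_apply] at hn
    calc _ ≤ Mallows.prob n (q n) (Mallows.clusterEvent n (m + 1) k) * (1 - q n ^ B) ^ (m + 1) := by
          have := (sub_pos.2 he1).le
          gcongr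
      _ ≤ (1 - q n) ^ m * ((1 + ε) * (1 / ((m + 1 : ℕ) : ℝ) * (m + 1).factorial)
          * (1 - q n ^ ((n - (m + 1)) / 2)) ^ (m + 1)) := hb.trans (by gcongr)
      _ = _ := by ring
  -- Since a / n^α tends to 0, constant offsets in k and n - k do not affect the divergence.
  · have hmin : ∀ a : ℝ, Tendsto (fun n : ℕ => min (k n : ℝ) ((n : ℝ) - (k n : ℝ)) / (n : ℝ) ^ α
        - a / (n : ℝ) ^ α) atTop atTop := fun a => by
      simpa [sub_eq_add_neg] using hk.atTop_add (hpow.const_div_atTop a).neg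
    have hB : Tendsto (fun n => q n ^ (k n - 1)) atTop (𝓝 0) := by
      refine Mallows.tendsto_pow_zero hc hq hq0 (tendsto_atTop_mono (fun n => ?_) (hmin 1))
      have h1 : (k n : ℝ) ≤ (k n - 1 : ℕ) + 1 := by exact_mod_cast (by omega : k n ≤ k n - 1 + 1)
      rw [← sub_div]
      have := min_le_left (k n : ℝ) ((n : ℝ) - (k n : ℝ))
      gcongr
      linarith
    have hA : Tendsto (fun n => q n ^ (n - (m + 1) - (k n - 1))) atTop (𝓝 0) := by
      refine Mallows.tendsto_pow_zero hc hq hq0 (tendsto_atTop_mono (fun n => ?_) (hmin (m + 1)))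
      have h1 : (n : ℝ) ≤ (n - (m + 1) - (k n - 1) : ℕ) + (m + 1) + k n := by
        exact_mod_cast (by omega : n ≤ n - (m + 1) - (k n - 1) + (m + 1) + k n)
      rw [← sub_div]
      have := min_le_right (k n : ℝ) ((n : ℝ) - (k n : ℝ))
      gcongr
      linarith
    -- Admissibility of `k n` is not assumed; the growth condition forces it eventually.
    have hmem : ∀ᶠ n in atTop, 1 ≤ k n ∧ k n + (m + 1) ≤ n + 1 := by
      filter_upwards [(hmin (m + 1)).eventually_ge_atTop 0, eventually_gt_atTop 0] with n hn hn0
      have hn1 : (0 : ℝ) < n := by exact_mod_cast hn0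
      have hp := Real.rpow_pos_of_pos hn1 α
      rw [← sub_div, le_div_iff₀ hp, zero_mul, sub_nonneg, le_min_iff] at hn
      have h1 : m + 1 ≤ k n := by exact_mod_cast hn.1
      have h2 : m + 1 + k n ≤ n := by
        have : ((m : ℝ) + 1) + k n ≤ n := by linarith [hn.2]
        exact_mod_cast this
      omega
    refine ⟨fun ε hε => ?_, fun ε hε => ?_⟩
    · filter_upwards [hlower ε hε, hmem] with n hn hkn
      exact hn (k n) hkn
    · have hI := Mallows.integral_pow_mul_exp_ge m
      rw [← hβdef] at hI
      set I := ∫ x in (0 : ℝ)..1, x ^ m * Real.exp (-(m : ℝ) * x)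
      have hlim1 := hF.mul (hβ.add (hA.const_mul (m : ℝ)))
      have hlim2 := ((hB.const_sub 1).pow (m + 1)).const_mul ((1 + ε) * (I * (m + 1).factorial))
      have hlt : ((m + 1).factorial : ℝ) * (β + m * 0)
          < (1 + ε) * (I * (m + 1).factorial) * (1 - 0) ^ (m + 1) := by
        rw [sub_zero, one_pow, mul_one, mul_zero, add_zero]
        have h1 := mul_le_mul_of_nonneg_right hI hfac.le
        have h2 : 0 < ε * (I * (m + 1).factorial) := by
          have := hβ0.trans_le hI
          positivity
        linarith
      filter_upwards [hlim1.eventually_lt hlim2 hlt, hB.eventually_lt_const one_pos, hq0, hqlt,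
        hmem] with n hn he1 h0 h1 hkn
      -- No reflection is needed here: both q^A and q^B tend to 0.
      have hb := Mallows.prob_mul_le_add h0 h1 (n - (m + 1) - (k n - 1)) (k n - 1) hm
      rw [show n - (m + 1) - (k n - 1) + (k n - 1) + (m + 1) = n by omega,
        show k n - 1 + 1 = k n by omega] at hb
      have hh0 : 0 ≤ (1 - q n) ^ m := pow_nonneg (sub_pos.2 h1).le _
      have hpos : 0 < (1 - q n ^ (k n - 1)) ^ (m + 1) := pow_pos (sub_pos.2 he1) _
      rw [hr']
      refine le_of_mul_le_mul_right ?_ hpos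
      simp only [Pi.div_apply] at hn
      calc _ ≤ (1 - q n) ^ m * ((1 + ε) * (I * (m + 1).factorial)
            * (1 - q n ^ (k n - 1)) ^ (m + 1)) := hb.trans (by gcongr)
        _ = _ := by ring
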